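/- Let $\mathcal Z$ be a finite set and let $\mathcal T$ be a non-empty, compact, convex set of transition (row-stochastic) matrices on $\mathcal Z$ with separately specified rows, i.e. $\mathcal T=\{T: T(z,\cdot)\in\mathcal T_z \text{ for all } z\in\mathcal Z\}$ for some sets $\mathcal T_z$ of probability mass functions on $\mathcal Z$. Let $A\subseteq\mathcal Z$, let $\tau_A=\inf\{n\ge 0: Z_n\in A\}\in\mathbb N_0\cup\{+\infty\}$, and let $\overline h_A(x)$ be the supremum of $\mathbb E_{\mathbb P}[\tau_A\mid Z_0=x]$ over all homogeneous Markov chains $\mathbb P$ with transition matrix in $\mathcal T$. Let $\mathcal T^A$ be the set of the matrices in $\mathcal T$ with the states of $A$ made absorbing (each row indexed by $a\in A$ is replaced by the point mass at $a$; this affects no hitting time of $A$, and $\mathcal T^A=\mathcal T$ if $A$ already consists of absorbing states). For $f\in\mathbb R^{\mathcal Z}$ put $[\overline Tf](x)=\sup_{T\in\mathcal T^A}[Tf](x)$ and $[\underline Tf](x)=\inf_{T\in\mathcal T^A}[Tf](x)$. Say that $x$ lower reaches $A$ if $[\underline T^n\mathbb 1_A](x)>0$ for some integer $n\ge1$, and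 that $x$ upper reaches $y$ if $[\overline T^n\mathbb 1_{\{y\}}](x)>0$ for some integer $n\ge 1$. Let $\mathscr A$ be the set of the states $x\in A^c$ that do not lower reach $A$, let $\mathscr U$ be the set of the states $x\in A^c\setminus\mathscr A$ that upper reach some state of $\mathscr A$, and let $\mathscr B=\mathscr A\cup\mathscr U$. Then $\overline h_A(x)=+\infty$ for all $x\in\mathscr B$. Moreover, there is a matrix $\tilde T\in\mathcal T$ such that, with $\tilde T|_{A^c\setminus\mathscr B}$ the submatrix of $\tilde T$ indexed by $A^c\setminus\mathscr B$, the matrix $I-\tilde T|_{A^c\setminus\mathscr B}$ is invertible and $$\overline h_A|_{A^c\setminus\mathscr B}=(I-\tilde T|_{A^c\setminus\mathscr B})^{-1}\mathbf 1,$$ where $\mathbf 1$ is the vector of all ones. -/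

import Mathlib

open scoped ENNReal Matrix

/-- The path law `P` is that of a homogeneous Markov chain with transition matrix `T`:
`P(Z_{n+1} = z_{n+1} | Z_0 = z_0, …, Z_n = z_n) = T(z_n, z_{n+1})`, for every initial
distribution (written in product form, so that null histories carry no condition). -/
def IsHomogeneousMarkovChain {Z : Type*} [MeasurableSpace Z]
    (T : Matrix Z Z ℝ) (P : MeasureTheory.Measure (ℕ → Z)) : Prop :=
  ∀ (n : ℕ) (z : ℕ → Z),
    P {ω | ∀ i ≤ n + 1, ω i = z i} =
      P {ω | ∀ i ≤ n, ω i = z i} * ENNReal.ofReal (T (z n) (z (n + 1)))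

/-- The set of all (laws of) homogeneous Markov chains whose transition matrix is in `𝒯`. -/
def homogeneousChains {Z : Type*} [MeasurableSpace Z]
    (𝒯 : Set (Matrix Z Z ℝ)) : Set (MeasureTheory.Measure (ℕ → Z)) :=
  {P | MeasureTheory.IsProbabilityMeasure P ∧ ∃ T ∈ 𝒯, IsHomogeneousMarkovChain T P}

/-- The hitting time `τ_A = inf {n ≥ 0 : Z_n ∈ A}`, with `inf ∅ = +∞`. -/
noncomputable def hittingTimeOf {Z : Type*} (A : Set Z) (ω : ℕ → Z) : ℕ∞ :=
  ⨅ (n : ℕ) (_ : ω n ∈ A), (n : ℕ∞)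

/-- The upper expected hitting time: the supremum of `E_P[τ_A | Z_0 = x]` over all homogeneous
Markov chains `P` compatible with `𝒯` (for which the event `Z_0 = x` has positive probability). -/
noncomputable def upperExpectedHittingTime {Z : Type*} [MeasurableSpace Z]
    (𝒯 : Set (Matrix Z Z ℝ)) (A : Set Z) (x : Z) : ℝ≥0∞ :=
  ⨆ (P : MeasureTheory.Measure (ℕ → Z)) (_ : P ∈ homogeneousChains 𝒯)
    (_ : P {ω | ω 0 = x} ≠ 0),
    ∫⁻ ω, (hittingTimeOf A ω : ℝ≥0∞) ∂(ProbabilityTheory.cond P {ω | ω 0 = x})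

/-- `T` is a transition (row-stochastic) matrix. -/
def IsTransitionMatrix {Z : Type*} [Fintype Z] (T : Matrix Z Z ℝ) : Prop :=
  (∀ x y, 0 ≤ T x y) ∧ ∀ x, ∑ y, T x y = 1

/-- The rows of the matrices in `𝒯` are specified separately, row `z` varying in `R z`. -/
def SeparatelySpecifiedRows {Z : Type*} (𝒯 : Set (Matrix Z Z ℝ)) : Prop :=
  ∃ R : Z → Set (Z → ℝ), 𝒯 = {T | ∀ z, T z ∈ R z}

/-- The upper transition operator of `𝒯`. -/
noncomputable def upperTransition {Z : Type*} [Fintype Z]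
    (𝒯 : Set (Matrix Z Z ℝ)) (f : Z → ℝ) : Z → ℝ :=
  fun x => ⨆ T : 𝒯, ((T : Matrix Z Z ℝ) *ᵥ f) x

/-- The lower transition operator of `𝒯`. -/
noncomputable def lowerTransition {Z : Type*} [Fintype Z]
    (𝒯 : Set (Matrix Z Z ℝ)) (f : Z → ℝ) : Z → ℝ :=
  fun x => ⨅ T : 𝒯, ((T : Matrix Z Z ℝ) *ᵥ f) x

/-- The set `S` is upper reachable from `x`. -/
def UpperReaches {Z : Type*} [Fintype Z]
    (𝒯 : Set (Matrix Z Z ℝ)) (x : Z) (S : Set Z) : Prop :=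
  ∃ n : ℕ, 1 ≤ n ∧ 0 < (upperTransition 𝒯)^[n] (S.indicator 1) x

/-- The set `S` is lower reachable from `x`. -/
def LowerReaches {Z : Type*} [Fintype Z]
    (𝒯 : Set (Matrix Z Z ℝ)) (x : Z) (S : Set Z) : Prop :=
  ∃ n : ℕ, 1 ≤ n ∧ 0 < (lowerTransition 𝒯)^[n] (S.indicator 1) x

open scoped Classical in
/-- `T` with the states of `A` made absorbing: the chain is stopped once it is in `A`. -/
noncomputable def stopMatrix {Z : Type*} (A : Set Z) (T : Matrix Z Z ℝ) : Matrix Z Z ℝ :=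
  fun x y => if x ∈ A then (if x = y then 1 else 0) else T x y

/-- The set `𝒯` with the target states made absorbing. Reachability is understood for the process
stopped at `A`: what the chain does after it has hit the target is immaterial. If the states
of `A` are absorbing under every member of `𝒯`, then this is `𝒯` itself. -/
noncomputable def stoppedAt {Z : Type*} (A : Set Z) (𝒯 : Set (Matrix Z Z ℝ)) :
    Set (Matrix Z Z ℝ) :=
  stopMatrix A '' 𝒯

/-- The non-target states that do not lower reach `A`. -/
def lowerAbsorbingStates {Z : Type*} [Fintype Z]
    (𝒯 : Set (Matrix Z Z ℝ)) (A : Set Z) : Set Z :=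
  {x | x ∉ A ∧ ¬ LowerReaches (stoppedAt A 𝒯) x A}

/-- The other non-target states that upper reach a state that does not lower reach `A`. -/
def upperReachingStates {Z : Type*} [Fintype Z]
    (𝒯 : Set (Matrix Z Z ℝ)) (A : Set Z) : Set Z :=
  {x | x ∉ A ∧ x ∉ lowerAbsorbingStates 𝒯 A ∧
    ∃ y ∈ lowerAbsorbingStates 𝒯 A, UpperReaches (stoppedAt A 𝒯) x {y}}

/-- The union of the two sets above. -/
def infiniteStates {Z : Type*} [Fintype Z]
    (𝒯 : Set (Matrix Z Z ℝ)) (A : Set Z) : Set Z :=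
  lowerAbsorbingStates 𝒯 A ∪ upperReachingStates 𝒯 A

/-- The square submatrix of `T` indexed by the states in `C`. -/
def restrictTo {Z : Type*} (C : Set Z) (T : Matrix Z Z ℝ) : Matrix C C ℝ :=
  T.submatrix Subtype.val Subtype.val

/-! Outside `A`, the conditional expectation of `τ_A` is the sum of its tails, so a chain with
matrix `T` gives `∑ n, (K ^ n *ᵥ 1) x` with `K = killedMatrix A T`. Hence `upperExpectedHittingTime`
is the supremum of these series over `𝒯` (`upperExpectedHittingTime_eq_iSup`).

On `infiniteStates`, one matrix is assembled row by row: on the states that do not lower reach `A`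
its row keeps all mass among them, and elsewhere its row gives positive mass to a state nearer to
them. Survival probabilities are then bounded below uniformly in time and the series diverges
(`exists_pow_killedMatrix_bounded_below`).

The complement `C` of `A` and `infiniteStates` can be left only into `A`, and a common `N` gives a
positive lower probability of being in `A` after `N` steps, everywhere on `C`. So each restriction
`M` to `C` has `M ^ N *ᵥ 1 < 1`, and its series sums to `(1 - M)⁻¹ *ᵥ 1`. By compactness some matrix
maximizes the sum of the entries of this vector; exchanging one row at a time shows that it
maximizes every entry (`exists_maximal_absorptionTime`). -/

/-! ### Hitting times as series of survival probabilities -/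

section HittingTime

open MeasureTheory ProbabilityTheory Preorder

variable {Z : Type*}

open scoped Classical in
/-- `T` with the rows and the columns indexed by `A` set to zero: the chain is killed in `A`. -/
noncomputable def killedMatrix (A : Set Z) (T : Matrix Z Z ℝ) : Matrix Z Z ℝ :=
  fun x y => if x ∈ A ∨ y ∈ A then 0 else T x y

lemma Matrix.mulVec_one_apply {m n : Type*} [Fintype n] (M : Matrix m n ℝ) (x : m) :
    (M *ᵥ 1) x = ∑ y, M x y := by
  simp [Matrix.mulVec, dotProduct]

lemma killedMatrix_nonneg {A : Set Z} {T : Matrix Z Z ℝ} (hT : ∀ x y, 0 ≤ T x y) (x y : Z) :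
    0 ≤ killedMatrix A T x y := by
  unfold killedMatrix
  split_ifs
  exacts [le_rfl, hT x y]

lemma lt_hittingTimeOf_iff (A : Set Z) (ω : ℕ → Z) (n : ℕ) :
    (n : ℕ∞) < hittingTimeOf A ω ↔ ∀ i ≤ n, ω i ∉ A := by
  rw [← ENat.add_one_le_iff (ENat.natCast_ne_top n), hittingTimeOf]
  simp only [le_iInf_iff]
  refine ⟨fun h i hi hA => ?_, fun h i hA => ?_⟩
  · have := h i hA
    norm_cast at this
    omega
  · norm_cast
    by_contra hlt
    exact h i (by omega) hA

open scoped Classical in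
lemma ENat.toENNReal_eq_tsum_ite (t : ℕ∞) :
    (t : ℝ≥0∞) = ∑' n : ℕ, if (n : ℕ∞) < t then 1 else 0 := by
  induction t using ENat.recTopCoe with
  | top => simp
  | coe m =>
    rw [tsum_eq_sum (s := Finset.range m)]
    · rw [Finset.sum_congr rfl (g := fun _ => 1)]
      · simp
      · intro b hb
        simp at hb
        simp [hb]
    · intro b hb
      simp at hb
      simp [hb]

section Discrete

variable [MeasurableSpace Z] [DiscreteMeasurableSpace Z]

lemma measurableSet_apply_eq (n : ℕ) (y : Z) : MeasurableSet {ω : ℕ → Z | ω n = y} := by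
  change MeasurableSet ((fun ω : ℕ → Z => ω n) ⁻¹' {y})
  exact measurable_pi_apply n (MeasurableSet.singleton y)

lemma measurableSet_avoid (A : Set Z) (n : ℕ) :
    MeasurableSet {ω : ℕ → Z | ∀ i ≤ n, ω i ∉ A} := by
  have : {ω : ℕ → Z | ∀ i ≤ n, ω i ∉ A} = ⋂ i, ⋂ (_ : i ≤ n), (fun ω : ℕ → Z => ω i) ⁻¹' Aᶜ := by
    ext; simp
  rw [this]
  exact MeasurableSet.iInter fun i => MeasurableSet.iInter fun _ =>
    measurable_pi_apply i (MeasurableSet.of_discrete)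

lemma lintegral_hittingTimeOf (A : Set Z) (P : Measure (ℕ → Z)) :
    ∫⁻ ω, (hittingTimeOf A ω : ℝ≥0∞) ∂P = ∑' n : ℕ, P {ω | ∀ i ≤ n, ω i ∉ A} := by
  have h : ∀ ω, (hittingTimeOf A ω : ℝ≥0∞) =
      ∑' n : ℕ, {ω : ℕ → Z | ∀ i ≤ n, ω i ∉ A}.indicator 1 ω := by
    intro ω
    rw [ENat.toENNReal_eq_tsum_ite]
    refine tsum_congr fun n => ?_
    by_cases hn : (n : ℕ∞) < hittingTimeOf A ω
    · rw [if_pos hn, Set.indicator_of_mem (by exact (lt_hittingTimeOf_iff A ω n).1 hn), Pi.one_apply]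
    · rw [if_neg hn, Set.indicator_of_notMem
        (fun h => hn ((lt_hittingTimeOf_iff A ω n).2 (by exact h)))]
  simp_rw [h]
  rw [lintegral_tsum fun n => (measurable_one.indicator (measurableSet_avoid A n)).aemeasurable]
  exact tsum_congr fun n => lintegral_indicator_one (measurableSet_avoid A n)

variable [Fintype Z]

/-- The definition conditions on one full history; summing over the finitely many histories in `S`
that end in `y` gives the Markov property for events. -/
lemma IsHomogeneousMarkovChain.measure_step {T : Matrix Z Z ℝ} {P : Measure (ℕ → Z)}
    (hP : IsHomogeneousMarkovChain T P) (n : ℕ) (S : Set (Finset.Iic n → Z)) (y y' : Z) :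
    P {ω | (frestrictLe n ω ∈ S ∧ ω n = y) ∧ ω (n + 1) = y'} =
      P {ω | frestrictLe n ω ∈ S ∧ ω n = y} * ENNReal.ofReal (T y y') := by
  classical
  set F : (ℕ → Z) → (Finset.Iic n → Z) := frestrictLe n with hF
  have hFm : Measurable F := measurable_frestrictLe n
  set S' : Set (Finset.Iic n → Z) := S ∩ {w | w ⟨n, by simp⟩ = y} with hS'
  have e1 : {ω | F ω ∈ S ∧ ω n = y} = F ⁻¹' S' := by
    ext ω; simp [hS', hF]
  have hev : MeasurableSet {ω : ℕ → Z | ω (n + 1) = y'} :=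
    measurableSet_apply_eq (n + 1) y'
  have hm : ∀ w, MeasurableSet (F ⁻¹' {w}) := fun w => hFm (MeasurableSet.singleton w)
  have e2 : P {ω | (F ω ∈ S ∧ ω n = y) ∧ ω (n + 1) = y'} =
      (P.restrict {ω | ω (n + 1) = y'}) (F ⁻¹' S') := by
    rw [Measure.restrict_apply (hFm (Set.toFinite S').measurableSet), ← e1]
    rfl
  rw [e2, e1, ← Set.Finite.coe_toFinset (Set.toFinite S'),
    ← sum_measure_preimage_singleton _ fun w _ => hm w,
    ← sum_measure_preimage_singleton _ fun w _ => hm w, Finset.sum_mul]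
  refine Finset.sum_congr rfl fun w hw => ?_
  have hwy : w ⟨n, by simp⟩ = y := by
    simp [hS'] at hw; exact hw.2
  -- Continuing `w` by `y'` after time `n` lets one sequence describe both the history and its
  -- extension.
  have key := hP n (fun i => if h : i ≤ n then w ⟨i, by simpa using h⟩ else y')
  rw [Measure.restrict_apply (hm w)]
  have a1 : F ⁻¹' {w} = {ω | ∀ i ≤ n, ω i = if h : i ≤ n then w ⟨i, by simpa using h⟩ else y'} := by
    ext ω
    simp only [Set.mem_preimage, Set.mem_singleton_iff, Set.mem_ofPred_eq, hF, funext_iff]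
    refine ⟨fun h i hi => ?_, fun h i => ?_⟩
    · rw [dif_pos hi, ← h]; rfl
    · have := h i (Finset.mem_Iic.1 i.2)
      rw [dif_pos (Finset.mem_Iic.1 i.2)] at this
      exact this
  have a2 : F ⁻¹' {w} ∩ {ω | ω (n + 1) = y'} = {ω | ∀ i ≤ n + 1,
      ω i = if h : i ≤ n then w ⟨i, by simpa using h⟩ else y'} := by
    rw [a1]
    ext ω
    simp only [Set.mem_inter_iff, Set.mem_ofPred_eq]
    refine ⟨fun h i hi => ?_, fun h => ⟨fun i hi => h i (by omega), ?_⟩⟩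
    · rcases Nat.lt_or_eq_of_le hi with hi | rfl
      · exact h.1 i (by omega)
      · rw [dif_neg (by omega)]; exact h.2
    · have := h (n + 1) le_rfl
      rwa [dif_neg (by omega)] at this
  rw [a2, a1, key]
  simp [hwy]

open scoped Classical in
lemma IsHomogeneousMarkovChain.measure_avoid_eq {T : Matrix Z Z ℝ} {P : Measure (ℕ → Z)}
    (hP : IsHomogeneousMarkovChain T P) (hT : ∀ x y, 0 ≤ T x y) {A : Set Z} {x : Z} (hx : x ∉ A)
    (n : ℕ) (y : Z) :
    P {ω | (ω 0 = x ∧ ∀ i ≤ n, ω i ∉ A) ∧ ω n = y} =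
      P {ω | ω 0 = x} * ENNReal.ofReal ((killedMatrix A T ^ n) x y) := by
  induction n generalizing y with
  | zero =>
    rw [pow_zero, Matrix.one_apply]
    split_ifs with h
    · subst h
      rw [ENNReal.ofReal_one, mul_one]
      congr 1
      ext ω
      simp only [Set.mem_ofPred_eq, Nat.le_zero, forall_eq]
      constructor
      · exact fun h => h.2
      · intro h; rw [h]; exact ⟨⟨rfl, hx⟩, rfl⟩
    · rw [ENNReal.ofReal_zero, mul_zero]
      convert measure_empty (μ := P)
      ext ω
      simp only [Set.mem_ofPred_eq, Set.mem_empty_iff_false, iff_false]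
      rintro ⟨⟨h1, -⟩, h2⟩
      exact h (h1.symm.trans h2)
  | succ n ih =>
    by_cases hy : y ∈ A
    · have h0 : (killedMatrix A T ^ (n + 1)) x y = 0 := by
        rw [pow_succ, Matrix.mul_apply]
        refine Finset.sum_eq_zero fun z _ => ?_
        simp [killedMatrix, hy]
      rw [h0, ENNReal.ofReal_zero, mul_zero]
      convert measure_empty (μ := P)
      ext ω
      simp only [Set.mem_ofPred_eq, Set.mem_empty_iff_false, iff_false]
      rintro ⟨⟨-, h1⟩, rfl⟩
      exact h1 _ le_rfl hy
    · have hstep : ∀ z : Z,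
          P {ω | ((ω 0 = x ∧ ∀ i ≤ n, ω i ∉ A) ∧ ω n = z) ∧ ω (n + 1) = y} =
          P {ω | ω 0 = x} * ENNReal.ofReal ((killedMatrix A T ^ n) x z * killedMatrix A T z y) := by
        intro z
        have h1 := hP.measure_step n {w | w ⟨0, by simp⟩ = x ∧ ∀ i, w i ∉ A} z y
        have e : ∀ ω : ℕ → Z, frestrictLe n ω ∈ {w : Finset.Iic n → Z |
            w ⟨0, by simp⟩ = x ∧ ∀ i, w i ∉ A} ↔ ω 0 = x ∧ ∀ i ≤ n, ω i ∉ A := by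
          intro ω
          simp
        simp only [e] at h1
        rw [h1, ih z, mul_assoc, ENNReal.ofReal_mul (Matrix.pow_apply_nonneg
          (killedMatrix_nonneg hT) n x z)]
        -- The killed and the original entry may differ for `z ∈ A`, but no surviving mass sits
        -- there; at `n = 0` this uses `x ∉ A`.
        by_cases hz : z ∈ A
        · have h0 : (killedMatrix A T ^ n) x z = 0 := by
            cases n with
            | zero => rw [pow_zero, Matrix.one_apply_ne]; rintro rfl; exact hx hz
            | succ n =>
              rw [pow_succ, Matrix.mul_apply]
              refine Finset.sum_eq_zero fun z _ => ?_
              simp [killedMatrix, hz]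
          simp [h0]
        · have h0 : killedMatrix A T z y = T z y := by simp [killedMatrix, hy, hz]
          rw [h0]
      rw [pow_succ, Matrix.mul_apply, ENNReal.ofReal_sum_of_nonneg fun z _ =>
        mul_nonneg (Matrix.pow_apply_nonneg (killedMatrix_nonneg hT) n x z)
          (killedMatrix_nonneg hT z y), Finset.mul_sum]
      simp_rw [← hstep]
      set E : Set (ℕ → Z) := {ω | (ω 0 = x ∧ ∀ i ≤ n, ω i ∉ A) ∧ ω (n + 1) = y} with hE
      have hsum := sum_measure_preimage_singleton (μ := P.restrict E) (Finset.univ : Finset Z)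
        (f := fun ω => ω n) fun z _ => measurable_pi_apply n (MeasurableSet.singleton z)
      rw [Finset.coe_univ, Set.preimage_univ, Measure.restrict_apply_univ] at hsum
      have hEE : {ω : ℕ → Z | (ω 0 = x ∧ ∀ i ≤ n + 1, ω i ∉ A) ∧ ω (n + 1) = y} = E := by
        ext ω
        simp only [hE, Set.mem_ofPred_eq]
        refine ⟨fun h => ⟨⟨h.1.1, fun i hi => h.1.2 i (by omega)⟩, h.2⟩,
          fun h => ⟨⟨h.1.1, fun i hi => ?_⟩, h.2⟩⟩
        rcases Nat.lt_or_eq_of_le hi with hi | rfl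
        · exact h.1.2 i (by omega)
        · rwa [h.2]
      rw [hEE, ← hsum]
      refine Finset.sum_congr rfl fun z _ => ?_
      rw [Measure.restrict_apply (measurable_pi_apply n (MeasurableSet.singleton z))]
      congr 1
      ext ω
      simp only [hE, Set.mem_inter_iff, Set.mem_preimage, Set.mem_singleton_iff, Set.mem_ofPred_eq]
      tauto

open scoped Classical in
lemma IsHomogeneousMarkovChain.lintegral_cond_hittingTimeOf {T : Matrix Z Z ℝ}
    {P : Measure (ℕ → Z)} [IsFiniteMeasure P]
    (hP : IsHomogeneousMarkovChain T P) (hT : ∀ x y, 0 ≤ T x y) {A : Set Z} {x : Z} (hx : x ∉ A)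
    (h0 : P {ω | ω 0 = x} ≠ 0) :
    ∫⁻ ω, (hittingTimeOf A ω : ℝ≥0∞) ∂(ProbabilityTheory.cond P {ω | ω 0 = x}) =
      ∑' n : ℕ, ENNReal.ofReal ((killedMatrix A T ^ n *ᵥ 1) x) := by
  rw [lintegral_hittingTimeOf]
  refine tsum_congr fun n => ?_
  have hm0 : MeasurableSet {ω : ℕ → Z | ω 0 = x} :=
    measurableSet_apply_eq 0 x
  have hinter : P ({ω | ω 0 = x} ∩ {ω | ∀ i ≤ n, ω i ∉ A}) =
      P {ω | ω 0 = x} * ENNReal.ofReal ((killedMatrix A T ^ n *ᵥ 1) x) := by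
    set E : Set (ℕ → Z) := {ω | ω 0 = x} ∩ {ω | ∀ i ≤ n, ω i ∉ A} with hE
    have hsum := sum_measure_preimage_singleton (μ := P.restrict E) (Finset.univ : Finset Z)
      (f := fun ω => ω n) fun z _ => measurable_pi_apply n (MeasurableSet.singleton z)
    rw [Finset.coe_univ, Set.preimage_univ, Measure.restrict_apply_univ] at hsum
    rw [← hsum, Matrix.mulVec_one_apply,
      ENNReal.ofReal_sum_of_nonneg fun z _ =>
      Matrix.pow_apply_nonneg (killedMatrix_nonneg hT) n x z, Finset.mul_sum]
    refine Finset.sum_congr rfl fun z _ => ?_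
    rw [← hP.measure_avoid_eq hT hx,
      Measure.restrict_apply (measurable_pi_apply n (MeasurableSet.singleton z))]
    congr 1
    ext ω
    simp only [hE, Set.mem_inter_iff, Set.mem_preimage, Set.mem_singleton_iff, Set.mem_ofPred_eq]
    tauto
  rw [ProbabilityTheory.cond_apply hm0, hinter, ← mul_assoc,
    ENNReal.inv_mul_cancel h0 (measure_ne_top _ _), one_mul]

open scoped Classical in
/-- The probability mass function of the row `x` of a transition matrix. -/
noncomputable def IsTransitionMatrix.rowPMF {T : Matrix Z Z ℝ} (hT : IsTransitionMatrix T)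
    (x : Z) : PMF Z :=
  PMF.ofFintype (fun y => ENNReal.ofReal (T x y)) (by
    rw [← ENNReal.ofReal_sum_of_nonneg fun y _ => hT.1 x y, hT.2 x, ENNReal.ofReal_one])

/-- Ionescu-Tulcea, with kernels that look only at the last coordinate of the history. -/
lemma IsTransitionMatrix.exists_isHomogeneousMarkovChain {T : Matrix Z Z ℝ}
    (hT : IsTransitionMatrix T) (x : Z) :
    ∃ P : Measure (ℕ → Z), IsProbabilityMeasure P ∧ IsHomogeneousMarkovChain T P ∧
      P {ω | ω 0 = x} = 1 := by
  classical
  let K : Kernel Z Z := Kernel.ofFunOfCountable fun z => (hT.rowPMF z).toMeasure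
  have : IsMarkovKernel K := ⟨fun z => by
    change IsProbabilityMeasure (hT.rowPMF z).toMeasure
    infer_instance⟩
  let κ : (n : ℕ) → Kernel (Finset.Iic n → Z) Z := fun n =>
    K.comap (fun w => w ⟨n, by simp⟩) (measurable_pi_apply _)
  let P : Measure (ℕ → Z) := Kernel.trajMeasure (X := fun _ => Z) (Measure.dirac x) κ
  refine ⟨P, inferInstance, fun n z => ?_, ?_⟩
  · have h := Kernel.map_frestrictLe_trajMeasure_compProd_eq_map_trajMeasure (X := fun _ => Z)
      (μ₀ := Measure.dirac x) (κ := κ) (a := n)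
    have h2 := congrArg (fun μ => μ ({frestrictLe n z} ×ˢ {z (n + 1)})) h
    beta_reduce at h2
    rw [Measure.compProd_apply_prod (MeasurableSet.singleton _) (MeasurableSet.singleton _),
      lintegral_singleton, Measure.map_apply (by fun_prop) (MeasurableSet.singleton _),
      Measure.map_apply (by fun_prop)
        ((MeasurableSet.singleton _).prod (MeasurableSet.singleton _))] at h2
    have hk : κ n (frestrictLe n z) {z (n + 1)} = ENNReal.ofReal (T (z n) (z (n + 1))) := by
      change (hT.rowPMF (z n)).toMeasure {z (n + 1)} = _
      rw [PMF.toMeasure_apply_singleton _ _ (MeasurableSet.singleton _)]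
      rfl
    rw [hk, mul_comm] at h2
    have e1 : frestrictLe (π := fun _ => Z) n ⁻¹' {frestrictLe (π := fun _ => Z) n z} =
        {ω : ℕ → Z | ∀ i ≤ n, ω i = z i} := by
      ext ω
      simp [funext_iff]
    have e2 : (fun ω : ℕ → Z => (frestrictLe (π := fun _ => Z) n ω, ω (n + 1))) ⁻¹'
        ({frestrictLe n z} ×ˢ {z (n + 1)}) = {ω : ℕ → Z | ∀ i ≤ n + 1, ω i = z i} := by
      ext ω
      simp only [Set.mem_preimage, Set.mem_prod, Set.mem_singleton_iff, funext_iff,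
        Set.mem_ofPred_eq, frestrictLe_apply, Subtype.forall, Finset.mem_Iic]
      refine ⟨fun h i hi => ?_, fun h => ⟨fun i hi => h i (by omega), h _ le_rfl⟩⟩
      rcases Nat.lt_or_eq_of_le hi with hi | rfl
      · exact h.1 i (by omega)
      · exact h.2
    rw [e1, e2] at h2
    exact h2.symm
  · have h : P.map (frestrictLe 0) = (Measure.dirac x).map
        (MeasurableEquiv.piUnique (fun _ : Finset.Iic 0 => Z)).symm := by
      change Measure.map (frestrictLe (π := fun _ => Z) 0)
        (Measure.bind _ (Kernel.traj (X := fun _ => Z) κ 0)) = _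
      rw [Measure.map_comp _ _ (by fun_prop), Kernel.traj_map_frestrictLe, Kernel.partialTraj_self,
        Measure.id_comp]
    have h2 := congrArg (fun μ => μ {w | w ⟨0, by simp⟩ = x}) h
    beta_reduce at h2
    rw [Measure.map_apply (by fun_prop) (Set.toFinite _).measurableSet,
      Measure.map_apply (MeasurableEquiv.measurable _) (Set.toFinite _).measurableSet,
      Measure.dirac_apply' _ (MeasurableSet.of_discrete), Set.indicator_of_mem] at h2
    · exact h2
    · rfl

open scoped Classical in
lemma upperExpectedHittingTime_eq_iSup {𝒯 : Set (Matrix Z Z ℝ)}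
    (h_trans : ∀ T ∈ 𝒯, IsTransitionMatrix T) {A : Set Z} {x : Z} (hx : x ∉ A) :
    upperExpectedHittingTime 𝒯 A x =
      ⨆ T ∈ 𝒯, ∑' n : ℕ, ENNReal.ofReal ((killedMatrix A T ^ n *ᵥ 1) x) := by
  apply le_antisymm
  · refine iSup_le fun P => iSup_le fun ⟨hprob, T, hT, hP⟩ => iSup_le fun h0 => ?_
    rw [hP.lintegral_cond_hittingTimeOf (h_trans T hT).1 hx h0]
    exact le_iSup₂_of_le T hT le_rfl
  · refine iSup₂_le fun T hT => ?_
    obtain ⟨P, hprob, hP, h1⟩ := (h_trans T hT).exists_isHomogeneousMarkovChain x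
    have h0 : P {ω | ω 0 = x} ≠ 0 := by rw [h1]; exact one_ne_zero
    exact le_iSup_of_le P (le_iSup_of_le ⟨hprob, T, hT, hP⟩
      (le_iSup_of_le h0 (hP.lintegral_cond_hittingTimeOf (h_trans T hT).1 hx h0).ge))

end Discrete

end HittingTime

/-! ### Absorption times of transient nonnegative matrices -/

section AbsorptionTime

section Transient

variable {ι : Type*} [Fintype ι] [DecidableEq ι] {M : Matrix ι ι ℝ} {N : ℕ}

lemma Matrix.mulVec_mono_of_nonneg {m n : Type*} [Fintype n] {M : Matrix m n ℝ}
    (hM : ∀ x y, 0 ≤ M x y) {v w : n → ℝ} (h : v ≤ w) : M *ᵥ v ≤ M *ᵥ w := fun x =>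
  Finset.sum_le_sum fun y _ => mul_le_mul_of_nonneg_left (h y) (hM x y)

lemma Matrix.mulVec_nonneg_of_nonneg {m n : Type*} [Fintype n] {M : Matrix m n ℝ}
    (hM : ∀ x y, 0 ≤ M x y) {v : n → ℝ} (h : 0 ≤ v) : 0 ≤ M *ᵥ v := fun x =>
  Finset.sum_nonneg fun y _ => mul_nonneg (hM x y) (h y)

/-- The maximum principle for a nonnegative matrix some power of which is strictly
substochastic. -/
lemma Matrix.nonneg_of_mulVec_le_self (hM : ∀ x y, 0 ≤ M x y) (hN : ∀ x, (M ^ N *ᵥ 1) x < 1)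
    {w : ι → ℝ} (hw : M *ᵥ w ≤ w) : 0 ≤ w := by
  have hpow : ∀ n : ℕ, M ^ n *ᵥ w ≤ w := by
    intro n
    induction n with
    | zero => simp
    | succ n ih =>
      rw [pow_succ', ← Matrix.mulVec_mulVec]
      exact (Matrix.mulVec_mono_of_nonneg hM ih).trans hw
  intro x
  obtain ⟨x₀, -, hmin⟩ := Finset.exists_min_image Finset.univ w ⟨x, Finset.mem_univ x⟩
  refine le_trans ?_ (hmin x (Finset.mem_univ x))
  by_contra! hneg
  -- Applying `M ^ N` at the minimizer gives `w x₀ * (M ^ N *ᵥ 1) x₀ ≤ w x₀`, impossible for `w x₀ <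
  -- 0`.
  have h1 : (w x₀ • (1 : ι → ℝ)) ≤ w := fun y => by simpa using hmin y (Finset.mem_univ y)
  have h2 := Matrix.mulVec_mono_of_nonneg (Matrix.pow_apply_nonneg hM N) h1 x₀
  rw [Matrix.mulVec_smul, Pi.smul_apply, smul_eq_mul] at h2
  have h3 := h2.trans (hpow N x₀)
  simp only [Pi.zero_apply] at hneg
  nlinarith [hN x₀]

lemma Matrix.isUnit_one_sub_of_pow_lt_one (hM : ∀ x y, 0 ≤ M x y)
    (hN : ∀ x, (M ^ N *ᵥ 1) x < 1) : IsUnit (1 - M) := by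
  rw [← Matrix.mulVec_injective_iff_isUnit]
  have key : ∀ v : ι → ℝ, (1 - M) *ᵥ v = 0 → v = 0 := by
    intro v hv
    rw [Matrix.sub_mulVec, Matrix.one_mulVec, sub_eq_zero] at hv
    refine le_antisymm ?_ (nonneg_of_mulVec_le_self hM hN hv.ge)
    have : 0 ≤ -v := nonneg_of_mulVec_le_self hM hN (by rw [Matrix.mulVec_neg, ← hv])
    simpa using this
  intro v w h
  rw [← sub_eq_zero]
  exact key _ (by rw [Matrix.mulVec_sub, sub_eq_zero]; exact h)

/-- The expected time to absorption `(1 - M)⁻¹ 1` of the substochastic matrix `M`. -/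
noncomputable def Matrix.absorptionTime (M : Matrix ι ι ℝ) : ι → ℝ := (1 - M)⁻¹ *ᵥ 1

lemma Matrix.absorptionTime_eq (h : IsUnit (1 - M)) :
    M.absorptionTime = 1 + M *ᵥ M.absorptionTime := by
  have : (1 - M) *ᵥ M.absorptionTime = 1 := by
    rw [absorptionTime, Matrix.mulVec_mulVec,
      Matrix.mul_nonsing_inv _ ((Matrix.isUnit_iff_isUnit_det _).1 h), Matrix.one_mulVec]
  rw [Matrix.sub_mulVec, Matrix.one_mulVec] at this
  rw [← this, sub_add_cancel]

/-- Iterating `h = 1 + M *ᵥ h` gives partial sums `h - M ^ n *ᵥ h ≤ h`. The series therefore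
converges, which forces `M ^ n` to zero and removes the remainder. -/
lemma Matrix.hasSum_pow_mulVec_one (hM : ∀ x y, 0 ≤ M x y) (hN : ∀ x, (M ^ N *ᵥ 1) x < 1)
    (x : ι) : HasSum (fun n => (M ^ n *ᵥ 1) x) (M.absorptionTime x) := by
  have hu := isUnit_one_sub_of_pow_lt_one hM hN
  have hh := absorptionTime_eq hu
  set h := M.absorptionTime
  have hnn : ∀ n, 0 ≤ M ^ n *ᵥ (1 : ι → ℝ) := fun n =>
    mulVec_nonneg_of_nonneg (Matrix.pow_apply_nonneg hM n) zero_le_one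
  have hpos : 0 ≤ h := nonneg_of_mulVec_le_self hM hN (by
    intro y
    have := congrFun hh y
    simp only [Pi.add_apply, Pi.one_apply] at this
    linarith)
  have hpart : ∀ n, ∑ k ∈ Finset.range n, M ^ k *ᵥ (1 : ι → ℝ) = h - M ^ n *ᵥ h := by
    intro n
    induction n with
    | zero => simp
    | succ n ih =>
      have h1 : M ^ n *ᵥ h = M ^ n *ᵥ 1 + M ^ (n + 1) *ᵥ h := by
        conv_lhs => rw [hh]
        rw [Matrix.mulVec_add, Matrix.mulVec_mulVec, pow_succ]
      rw [Finset.sum_range_succ, ih, h1]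
      abel
  have hsummable : ∀ y, Summable fun n => (M ^ n *ᵥ (1 : ι → ℝ)) y := fun y =>
    summable_of_sum_range_le (c := h y) (fun n => hnn n y) fun n => by
      have := congrFun (hpart n) y
      rw [Finset.sum_apply] at this
      rw [this, Pi.sub_apply]
      have := mulVec_nonneg_of_nonneg (Matrix.pow_apply_nonneg hM n) hpos y
      simp only [Pi.zero_apply] at this
      linarith
  have hentry : ∀ y z, Filter.Tendsto (fun n => (M ^ n) y z) Filter.atTop (nhds 0) := by
    intro y z
    refine squeeze_zero (fun n => Matrix.pow_apply_nonneg hM n y z) (fun n => ?_)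
      (hsummable y).tendsto_atTop_zero
    rw [mulVec_one_apply]
    exact Finset.single_le_sum (f := fun z => (M ^ n) y z)
      (fun z _ => Matrix.pow_apply_nonneg hM n y z) (Finset.mem_univ z)
  rw [(hsummable x).hasSum_iff_tendsto_nat]
  have hlim : Filter.Tendsto (fun n => h x - (M ^ n *ᵥ h) x) Filter.atTop (nhds (h x)) := by
    have : Filter.Tendsto (fun n => (M ^ n *ᵥ h) x) Filter.atTop (nhds 0) := by
      have := tendsto_finsetSum (Finset.univ : Finset ι) fun z _ =>
        (hentry x z).mul_const (h z)
      simpa [Matrix.mulVec, dotProduct] using this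
    simpa using this.const_sub (h x)
  refine hlim.congr fun n => ?_
  rw [← Pi.sub_apply, ← hpart n, Finset.sum_apply]

end Transient

end AbsorptionTime

/-! ### Lower and upper reachability in the stopped process -/

section Reachability

variable {Z : Type*} {A : Set Z} {𝒯 : Set (Matrix Z Z ℝ)}

/-- The form in which separate specification is used: rows chosen from different members recombine.
-/
lemma SeparatelySpecifiedRows.mem_of_rows (h : SeparatelySpecifiedRows 𝒯)
    {r : Z → Matrix Z Z ℝ} (hr : ∀ z, r z ∈ 𝒯) : (fun z => r z z : Matrix Z Z ℝ) ∈ 𝒯 := by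
  obtain ⟨R, rfl⟩ := h
  exact fun z => hr z z

lemma stopMatrix_apply_of_notMem {T : Matrix Z Z ℝ} {x : Z} (hx : x ∉ A) :
    stopMatrix A T x = T x := by
  funext y
  simp [stopMatrix, hx]

variable [Fintype Z]

lemma IsTransitionMatrix.stopMatrix {T : Matrix Z Z ℝ} (hT : IsTransitionMatrix T) (A : Set Z) :
    IsTransitionMatrix (stopMatrix A T) := by
  classical
  refine ⟨fun x y => ?_, fun x => ?_⟩
  · unfold _root_.stopMatrix
    split_ifs
    exacts [zero_le_one, le_rfl, hT.1 x y]
  · by_cases hx : x ∈ A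
    · simp [_root_.stopMatrix, hx]
    · rw [stopMatrix_apply_of_notMem hx]
      exact hT.2 x

lemma isTransitionMatrix_of_mem_stoppedAt (h_trans : ∀ T ∈ 𝒯, IsTransitionMatrix T) :
    ∀ T ∈ stoppedAt A 𝒯, IsTransitionMatrix T := by
  rintro _ ⟨T, hT, rfl⟩
  exact (h_trans T hT).stopMatrix A

lemma stopMatrix_mulVec_of_mem {T : Matrix Z Z ℝ} {x : Z} (hx : x ∈ A) (f : Z → ℝ) :
    (stopMatrix A T *ᵥ f) x = f x := by
  classical
  simp [stopMatrix, hx, Matrix.mulVec, dotProduct]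

lemma stopMatrix_mulVec_of_notMem {T : Matrix Z Z ℝ} {x : Z} (hx : x ∉ A) (f : Z → ℝ) :
    (stopMatrix A T *ᵥ f) x = (T *ᵥ f) x := by
  simp only [Matrix.mulVec, stopMatrix_apply_of_notMem hx]

lemma IsTransitionMatrix.mulVec_one {T : Matrix Z Z ℝ} (hT : IsTransitionMatrix T) :
    T *ᵥ 1 = 1 := by
  funext x
  rw [Matrix.mulVec_one_apply, hT.2 x, Pi.one_apply]

section Operators

variable {f g : Z → ℝ} {T : Matrix Z Z ℝ}

lemma bddBelow_range_mulVec (h_trans : ∀ T ∈ 𝒯, IsTransitionMatrix T) (hf : 0 ≤ f) (x : Z) :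
    BddBelow (Set.range fun T : 𝒯 => ((T : Matrix Z Z ℝ) *ᵥ f) x) :=
  ⟨0, by
    rintro _ ⟨T, rfl⟩
    exact Matrix.mulVec_nonneg_of_nonneg (h_trans T T.2).1 hf x⟩

lemma bddAbove_range_mulVec (h_trans : ∀ T ∈ 𝒯, IsTransitionMatrix T) (hf : 0 ≤ f) (x : Z) :
    BddAbove (Set.range fun T : 𝒯 => ((T : Matrix Z Z ℝ) *ᵥ f) x) :=
  ⟨∑ y, f y, by
    rintro _ ⟨T, rfl⟩
    refine Finset.sum_le_sum fun y _ => ?_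
    have h1 : (T : Matrix Z Z ℝ) x y ≤ 1 := by
      rw [← (h_trans T T.2).2 x]
      exact Finset.single_le_sum (fun z _ => (h_trans T T.2).1 x z) (Finset.mem_univ y)
    simpa using mul_le_mul_of_nonneg_right h1 (hf y)⟩

lemma lowerTransition_le (h_trans : ∀ T ∈ 𝒯, IsTransitionMatrix T) (hf : 0 ≤ f) (hT : T ∈ 𝒯) :
    lowerTransition 𝒯 f ≤ T *ᵥ f := fun x =>
  ciInf_le (bddBelow_range_mulVec h_trans hf x) (⟨T, hT⟩ : 𝒯)

lemma le_upperTransition (h_trans : ∀ T ∈ 𝒯, IsTransitionMatrix T) (hf : 0 ≤ f) (hT : T ∈ 𝒯) :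
    T *ᵥ f ≤ upperTransition 𝒯 f := fun x =>
  le_ciSup (bddAbove_range_mulVec h_trans hf x) (⟨T, hT⟩ : 𝒯)

lemma lowerTransition_nonneg (h_trans : ∀ T ∈ 𝒯, IsTransitionMatrix T) (hf : 0 ≤ f) :
    0 ≤ lowerTransition 𝒯 f := fun x =>
  Real.iInf_nonneg fun T => Matrix.mulVec_nonneg_of_nonneg (h_trans T T.2).1 hf x

lemma upperTransition_nonneg (h_trans : ∀ T ∈ 𝒯, IsTransitionMatrix T) (hf : 0 ≤ f) :
    0 ≤ upperTransition 𝒯 f := fun x =>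
  Real.iSup_nonneg fun T => Matrix.mulVec_nonneg_of_nonneg (h_trans T T.2).1 hf x

lemma lowerTransition_mono (h_trans : ∀ T ∈ 𝒯, IsTransitionMatrix T) (hf : 0 ≤ f) (hfg : f ≤ g) :
    lowerTransition 𝒯 f ≤ lowerTransition 𝒯 g := fun x =>
  ciInf_mono (bddBelow_range_mulVec h_trans hf x) fun T =>
    Matrix.mulVec_mono_of_nonneg (h_trans T T.2).1 hfg x

lemma iterate_upperTransition_nonneg (h_trans : ∀ T ∈ 𝒯, IsTransitionMatrix T) (hf : 0 ≤ f)
    (n : ℕ) : 0 ≤ (upperTransition 𝒯)^[n] f := by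
  induction n with
  | zero => exact hf
  | succ n ih => rw [Function.iterate_succ_apply']; exact upperTransition_nonneg h_trans ih

lemma iterate_lowerTransition_nonneg (h_trans : ∀ T ∈ 𝒯, IsTransitionMatrix T) (hf : 0 ≤ f)
    (n : ℕ) : 0 ≤ (lowerTransition 𝒯)^[n] f := by
  induction n with
  | zero => exact hf
  | succ n ih => rw [Function.iterate_succ_apply']; exact lowerTransition_nonneg h_trans ih

lemma iterate_lowerTransition_le_one (h_trans : ∀ T ∈ 𝒯, IsTransitionMatrix T)
    (h_nonempty : 𝒯.Nonempty) (hf : 0 ≤ f) (hf1 : f ≤ 1) (n : ℕ) :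
    (lowerTransition 𝒯)^[n] f ≤ 1 := by
  induction n with
  | zero => exact hf1
  | succ n ih =>
    rw [Function.iterate_succ_apply']
    obtain ⟨T, hT⟩ := h_nonempty
    refine (lowerTransition_le h_trans (iterate_lowerTransition_nonneg h_trans hf n) hT).trans ?_
    rw [← (h_trans T hT).mulVec_one]
    exact Matrix.mulVec_mono_of_nonneg (h_trans T hT).1 ih

lemma exists_pos_of_upperTransition_pos (h_trans : ∀ T ∈ 𝒯, IsTransitionMatrix T)
    (h_nonempty : 𝒯.Nonempty) {x : Z} (h : 0 < upperTransition 𝒯 f x) :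
    ∃ T ∈ 𝒯, ∃ z, 0 < T x z ∧ 0 < f z := by
  have := h_nonempty.to_subtype
  obtain ⟨T, hT⟩ := exists_lt_of_lt_ciSup h
  obtain ⟨z, -, hz⟩ := Finset.exists_lt_of_sum_lt (s := Finset.univ) (f := fun _ => (0 : ℝ))
    (g := fun z => (T : Matrix Z Z ℝ) x z * f z) (by rw [Finset.sum_const_zero]; exact hT)
  have h0 := (h_trans T T.2).1 x z
  have h1 : 0 < (T : Matrix Z Z ℝ) x z := lt_of_le_of_ne h0 fun h => by simp [← h] at hz
  exact ⟨T, T.2, z, h1, (mul_pos_iff_of_pos_left h1).1 hz⟩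

end Operators

section Stopped

lemma indicator_le_lowerTransition (h_trans : ∀ T ∈ 𝒯, IsTransitionMatrix T)
    (h_nonempty : 𝒯.Nonempty) :
    A.indicator 1 ≤ lowerTransition (stoppedAt A 𝒯) (A.indicator 1) := by
  intro x
  have := (h_nonempty.image (stopMatrix A)).to_subtype
  refine le_ciInf (α := ℝ) (ι := stopMatrix A '' 𝒯) ?_
  rintro ⟨_, T, hT, rfl⟩
  by_cases hx : x ∈ A
  · rw [stopMatrix_mulVec_of_mem hx]
  · rw [Set.indicator_of_notMem hx]
    exact Matrix.mulVec_nonneg_of_nonneg ((h_trans T hT).stopMatrix A).1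
      (Set.indicator_nonneg fun _ _ => zero_le_one) x

/-- Holds because `A` is absorbing after stopping; it lets step counts depending on the state be
replaced by their maximum. -/
lemma monotone_iterate_lowerTransition (h_trans : ∀ T ∈ 𝒯, IsTransitionMatrix T)
    (h_nonempty : 𝒯.Nonempty) :
    Monotone fun n => (lowerTransition (stoppedAt A 𝒯))^[n] (A.indicator 1) := by
  refine monotone_nat_of_le_succ fun n => ?_
  induction n with
  | zero => exact indicator_le_lowerTransition h_trans h_nonempty
  | succ n ih =>
    rw [Function.iterate_succ_apply', Function.iterate_succ_apply' _ (n + 1)]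
    exact lowerTransition_mono (isTransitionMatrix_of_mem_stoppedAt h_trans)
      (iterate_lowerTransition_nonneg (isTransitionMatrix_of_mem_stoppedAt h_trans)
        (Set.indicator_nonneg fun _ _ => zero_le_one) n) ih

lemma exists_iterate_lowerTransition_pos (h_trans : ∀ T ∈ 𝒯, IsTransitionMatrix T)
    (h_nonempty : 𝒯.Nonempty) :
    ∃ N, ∀ y ∉ lowerAbsorbingStates 𝒯 A,
      0 < (lowerTransition (stoppedAt A 𝒯))^[N] (A.indicator 1) y := by
  have h : ∀ y, ∃ n, y ∉ lowerAbsorbingStates 𝒯 A →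
      0 < (lowerTransition (stoppedAt A 𝒯))^[n] (A.indicator 1) y := by
    intro y
    by_cases hA : y ∈ A
    · exact ⟨0, fun _ => by simp [hA]⟩
    · by_cases hL : LowerReaches (stoppedAt A 𝒯) y A
      · obtain ⟨n, -, hn⟩ := hL
        exact ⟨n, fun _ => hn⟩
      · exact ⟨0, fun h => (h ⟨hA, hL⟩).elim⟩
  choose n hn using h
  refine ⟨Finset.univ.sup n, fun y hy => (hn y hy).trans_le ?_⟩
  exact monotone_iterate_lowerTransition h_trans h_nonempty (Finset.le_sup (Finset.mem_univ y)) y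

lemma exists_mulVec_le_lowerTransition (h_nonempty : 𝒯.Nonempty) (h_compact : IsCompact 𝒯)
    {x : Z} (hx : x ∉ A) {f : Z → ℝ} :
    ∃ T ∈ 𝒯, (T *ᵥ f) x ≤ lowerTransition (stoppedAt A 𝒯) f x := by
  have hc : Continuous fun T : Matrix Z Z ℝ => (T *ᵥ f) x :=
    (continuous_apply x).comp (continuous_id.matrix_mulVec continuous_const)
  obtain ⟨T, hT, hmin⟩ := h_compact.exists_isMinOn h_nonempty hc.continuousOn
  refine ⟨T, hT, ?_⟩
  have := (h_nonempty.image (stopMatrix A)).to_subtype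
  refine le_ciInf (α := ℝ) (ι := stopMatrix A '' 𝒯) ?_
  rintro ⟨_, S, hS, rfl⟩
  rw [stopMatrix_mulVec_of_notMem hx]
  exact hmin hS

/-- For the uniform `N`, the `N`-th lower iterate is positive off `lowerAbsorbingStates`, while the
next one vanishes at `x`. By compactness a row attains that zero, so it puts no mass where the
`N`-th iterate is positive. -/
lemma exists_row_supported_lowerAbsorbingStates (h_trans : ∀ T ∈ 𝒯, IsTransitionMatrix T)
    (h_nonempty : 𝒯.Nonempty) (h_compact : IsCompact 𝒯) {x : Z}
    (hx : x ∈ lowerAbsorbingStates 𝒯 A) :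
    ∃ T ∈ 𝒯, ∀ y ∉ lowerAbsorbingStates 𝒯 A, T x y = 0 := by
  obtain ⟨N, hN⟩ := exists_iterate_lowerTransition_pos (A := A) h_trans h_nonempty
  obtain ⟨T, hT, hle⟩ := exists_mulVec_le_lowerTransition h_nonempty h_compact hx.1
    (f := (lowerTransition (stoppedAt A 𝒯))^[N] (A.indicator 1))
  refine ⟨T, hT, fun y hy => ?_⟩
  rw [← Function.iterate_succ_apply' (lowerTransition _)] at hle
  have h0 : (lowerTransition (stoppedAt A 𝒯))^[N + 1] (A.indicator 1) x ≤ 0 := by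
    by_contra! h
    exact hx.2 ⟨N + 1, by omega, h⟩
  have hg := iterate_lowerTransition_nonneg (isTransitionMatrix_of_mem_stoppedAt (A := A) h_trans)
    (f := A.indicator 1) (Set.indicator_nonneg fun _ _ => zero_le_one) N
  have hterm := (Finset.single_le_sum (f := fun z => T x z *
    (lowerTransition (stoppedAt A 𝒯))^[N] (A.indicator 1) z)
    (fun z _ => mul_nonneg ((h_trans T hT).1 x z) (hg z)) (Finset.mem_univ y)).trans (hle.trans h0)
  exact le_antisymm (nonpos_of_mul_nonpos_left hterm (hN y hy)) ((h_trans T hT).1 x y)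

lemma iterate_upperTransition_of_mem (h_nonempty : 𝒯.Nonempty) {x : Z} (hx : x ∈ A)
    (f : Z → ℝ) (n : ℕ) : (upperTransition (stoppedAt A 𝒯))^[n] f x = f x := by
  induction n with
  | zero => rfl
  | succ n ih =>
    rw [Function.iterate_succ_apply', upperTransition]
    have := (h_nonempty.image (stopMatrix A)).to_subtype
    rw [← ih]
    refine (iSup_congr (ι := stopMatrix A '' 𝒯) ?_).trans (ciSup_const (ι := stopMatrix A '' 𝒯))
    rintro ⟨_, T, hT, rfl⟩
    rw [stopMatrix_mulVec_of_mem hx]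

omit [Fintype Z] in
lemma indicator_singleton_nonneg (w : Z) : (0 : Z → ℝ) ≤ ({w} : Set Z).indicator 1 :=
  Set.indicator_nonneg fun _ _ => zero_le_one

lemma exists_iterate_upperTransition_pos {x : Z} (hx : x ∈ infiniteStates 𝒯 A) :
    ∃ n, ∃ w ∈ lowerAbsorbingStates 𝒯 A,
      0 < (upperTransition (stoppedAt A 𝒯))^[n] (({w} : Set Z).indicator 1) x := by
  rcases hx with hx | ⟨-, -, w, hw, n, -, hn⟩
  -- Allowing `n = 0` covers the states that do not lower reach `A`, giving them distance zero.
  · exact ⟨0, x, hx, by simp⟩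
  · exact ⟨n, w, hw, hn⟩

lemma notMem_of_mem_infiniteStates {x : Z} (hx : x ∈ infiniteStates 𝒯 A) : x ∉ A := by
  rcases hx with hx | hx <;> exact hx.1

/-- Prefixing one step to an upper path. Contrapositively, the remaining states can be left only
into `A`. -/
lemma mem_infiniteStates_of_step (h_trans : ∀ T ∈ 𝒯, IsTransitionMatrix T)
    {x y : Z} (hx : x ∉ A) {T : Matrix Z Z ℝ} (hT : T ∈ 𝒯) (hxy : 0 < T x y)
    (hy : y ∈ infiniteStates 𝒯 A) : x ∈ infiniteStates 𝒯 A := by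
  by_cases hL : x ∈ lowerAbsorbingStates 𝒯 A
  · exact Or.inl hL
  obtain ⟨n, w, hw, hn⟩ := exists_iterate_upperTransition_pos hy
  refine Or.inr ⟨hx, hL, w, hw, n + 1, by omega, ?_⟩
  have ht := isTransitionMatrix_of_mem_stoppedAt (A := A) h_trans
  have hg := iterate_upperTransition_nonneg ht (indicator_singleton_nonneg w) n
  rw [Function.iterate_succ_apply']
  refine lt_of_lt_of_le ?_ (le_upperTransition ht hg (Set.mem_image_of_mem _ hT) x)
  rw [stopMatrix_mulVec_of_notMem hx]
  exact (mul_pos hxy hn).trans_le (Finset.single_le_sum (f := fun z => T x z *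
    (upperTransition (stoppedAt A 𝒯))^[n] (({w} : Set Z).indicator 1) z)
    (fun z _ => mul_nonneg ((h_trans T hT).1 x z) (hg z)) (Finset.mem_univ y))

/-- The least number of steps in which `x` upper reaches a state that does not lower
reach `A`. -/
noncomputable def upperDistance (𝒯 : Set (Matrix Z Z ℝ)) (A : Set Z) (x : Z) : ℕ :=
  sInf {n | ∃ w ∈ lowerAbsorbingStates 𝒯 A,
    0 < (upperTransition (stoppedAt A 𝒯))^[n] (({w} : Set Z).indicator 1) x}

/-- The first step of a shortest upper path shortens the distance. -/
lemma exists_row_decreasing_upperDistance (h_trans : ∀ T ∈ 𝒯, IsTransitionMatrix T)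
    (h_nonempty : 𝒯.Nonempty) {x : Z} (hx : x ∈ infiniteStates 𝒯 A)
    (hL : x ∉ lowerAbsorbingStates 𝒯 A) :
    ∃ T ∈ 𝒯, ∃ z ∈ infiniteStates 𝒯 A, 0 < T x z ∧
      upperDistance 𝒯 A z < upperDistance 𝒯 A x := by
  classical
  have hxA := notMem_of_mem_infiniteStates hx
  obtain ⟨w, hw, hpos⟩ := Nat.sInf_mem (exists_iterate_upperTransition_pos hx)
  change 0 < (upperTransition (stoppedAt A 𝒯))^[upperDistance 𝒯 A x] _ x at hpos
  rcases hd : upperDistance 𝒯 A x with _ | m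
  · rw [hd, Function.iterate_zero, id, Set.indicator_apply] at hpos
    split_ifs at hpos with h
    · rw [Set.mem_singleton_iff] at h
      exact (hL (h ▸ hw)).elim
    · exact (lt_irrefl _ hpos).elim
  · rw [hd, Function.iterate_succ_apply'] at hpos
    obtain ⟨_, ⟨T, hT, rfl⟩, z, hz, hfz⟩ := exists_pos_of_upperTransition_pos
      (isTransitionMatrix_of_mem_stoppedAt h_trans) (h_nonempty.image _) hpos
    rw [stopMatrix_apply_of_notMem hxA] at hz
    -- A path through `A` would stay there and never reach `w ∉ A`.
    have hzA : z ∉ A := by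
      intro hzA
      rw [iterate_upperTransition_of_mem h_nonempty hzA,
        Set.indicator_of_notMem (by rintro rfl; exact hw.1 hzA)] at hfz
      exact lt_irrefl _ hfz
    refine ⟨T, hT, z, ?_, hz, Nat.lt_succ_of_le (Nat.sInf_le ⟨w, hw, hfz⟩)⟩
    by_cases hzL : z ∈ lowerAbsorbingStates 𝒯 A
    · exact Or.inl hzL
    · rcases m with _ | m
      · rw [Function.iterate_zero, id, Set.indicator_apply] at hfz
        split_ifs at hfz with h
        · rw [Set.mem_singleton_iff] at h
          exact (hzL (h ▸ hw)).elim
        · exact (lt_irrefl _ hfz).elim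
      · exact Or.inr ⟨hzA, hzL, w, hw, m + 1, by omega, hfz⟩

omit [Fintype Z] in
lemma killedMatrix_of_notMem {T : Matrix Z Z ℝ} {x y : Z} (hx : x ∉ A) (hy : y ∉ A) :
    killedMatrix A T x y = T x y := by simp [killedMatrix, hx, hy]

open scoped Classical in
lemma exists_pow_killedMatrix_bounded_below (h_trans : ∀ T ∈ 𝒯, IsTransitionMatrix T)
    (h_nonempty : 𝒯.Nonempty) (h_compact : IsCompact 𝒯) (h_ssr : SeparatelySpecifiedRows 𝒯) :
    ∃ T ∈ 𝒯, ∀ x ∈ infiniteStates 𝒯 A, ∃ ε > 0, ∀ n, ε ≤ (killedMatrix A T ^ n *ᵥ 1) x := by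
  have hrow : ∀ x, ∃ T ∈ 𝒯,
      (x ∈ lowerAbsorbingStates 𝒯 A → ∀ y ∉ lowerAbsorbingStates 𝒯 A, T x y = 0) ∧
      (x ∈ infiniteStates 𝒯 A → x ∉ lowerAbsorbingStates 𝒯 A → ∃ z ∈ infiniteStates 𝒯 A,
        0 < T x z ∧ upperDistance 𝒯 A z < upperDistance 𝒯 A x) := by
    intro x
    by_cases hL : x ∈ lowerAbsorbingStates 𝒯 A
    · obtain ⟨T, hT, h⟩ := exists_row_supported_lowerAbsorbingStates h_trans h_nonempty h_compact hL
      exact ⟨T, hT, fun _ => h, fun _ h => (h hL).elim⟩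
    · by_cases hx : x ∈ infiniteStates 𝒯 A
      · obtain ⟨T, hT, h⟩ := exists_row_decreasing_upperDistance h_trans h_nonempty hx hL
        exact ⟨T, hT, fun h => (hL h).elim, fun _ _ => h⟩
      · obtain ⟨T, hT⟩ := h_nonempty
        exact ⟨T, hT, fun h => (hL h).elim, fun h => (hx h).elim⟩
  choose r hr hr1 hr2 using hrow
  obtain ⟨T, hT, hTr⟩ : ∃ T ∈ 𝒯, ∀ x, T x = r x x := ⟨_, h_ssr.mem_of_rows hr, fun _ => rfl⟩
  simp_rw [← hTr] at hr1 hr2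
  refine ⟨T, hT, ?_⟩
  have hT0 := (h_trans T hT).1
  have hpow0 : ∀ n, 0 ≤ killedMatrix A T ^ n *ᵥ (1 : Z → ℝ) := fun n =>
    Matrix.mulVec_nonneg_of_nonneg (Matrix.pow_apply_nonneg (killedMatrix_nonneg hT0) n) zero_le_one
  -- The chosen rows never leave this set, so survival is certain.
  have hL : ∀ n, ∀ x ∈ lowerAbsorbingStates 𝒯 A, 1 ≤ (killedMatrix A T ^ n *ᵥ 1) x := by
    intro n
    induction n with
    | zero => intro x _; simp
    | succ n ih =>
      intro x hx
      rw [pow_succ', ← Matrix.mulVec_mulVec, ← (h_trans T hT).2 x]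
      refine Finset.sum_le_sum fun y _ => ?_
      beta_reduce
      by_cases hy : y ∈ lowerAbsorbingStates 𝒯 A
      · rw [killedMatrix_of_notMem hx.1 hy.1]
        exact le_mul_of_one_le_right (hT0 x y) (ih y hy)
      · rw [hr1 x hx y hy]
        exact mul_nonneg (killedMatrix_nonneg hT0 x y) (hpow0 n y)
  have hd : ∀ m, ∀ x ∈ infiniteStates 𝒯 A, upperDistance 𝒯 A x = m →
      ∃ ε > 0, ∀ n, ε ≤ (killedMatrix A T ^ n *ᵥ 1) x := by
    intro m
    induction m using Nat.strong_induction_on with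
    | _ m ih =>
      intro x hx hm
      by_cases hxL : x ∈ lowerAbsorbingStates 𝒯 A
      · exact ⟨1, one_pos, fun n => hL n x hxL⟩
      · obtain ⟨z, hz, hpos, hlt⟩ := hr2 x hx hxL
        obtain ⟨ε, hε, hb⟩ := ih _ (hm ▸ hlt) z hz rfl
        -- The bound `1` serves time zero; later times first step to `z`.
        refine ⟨min 1 (T x z * ε), lt_min one_pos (mul_pos hpos hε), fun n => ?_⟩
        rcases n with _ | n
        · simp
        · refine (min_le_right _ _).trans ?_
          rw [pow_succ', ← Matrix.mulVec_mulVec]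
          refine (mul_le_mul_of_nonneg_left (hb n) hpos.le).trans ?_
          rw [← killedMatrix_of_notMem (T := T) (notMem_of_mem_infiniteStates hx)
            (notMem_of_mem_infiniteStates hz)]
          exact Finset.single_le_sum (f := fun y => killedMatrix A T x y *
            (killedMatrix A T ^ n *ᵥ 1) y)
            (fun y _ => mul_nonneg (killedMatrix_nonneg hT0 x y) (hpow0 n y)) (Finset.mem_univ z)
  exact fun x hx => hd _ x hx rfl

end Stopped

end Reachability

/-! ### A simultaneous maximizer of absorption times -/

section Maximization

variable {Z : Type*} {A : Set Z} {𝒯 : Set (Matrix Z Z ℝ)}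

lemma Fintype.sum_coe_eq_sum [Fintype Z] {C : Set Z} [Fintype C] {f : Z → ℝ}
    (hf : ∀ y ∉ C, f y = 0) : ∑ y : C, f y = ∑ y, f y := by
  rw [← tsum_fintype (L := .unconditional _), ← tsum_fintype (L := .unconditional _)]
  exact tsum_subtype_eq_of_support_subset fun y hy => by_contra fun h => hy (hf y h)

section Restrict

variable {C : Set Z} [Fintype C] [DecidableEq C]

omit [Fintype C] [DecidableEq C] in
lemma restrictTo_nonneg {T : Matrix Z Z ℝ} (hT : ∀ x y, 0 ≤ T x y) (x y : C) :
    0 ≤ restrictTo C T x y := hT x y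

/-- Cramer's rule: the inverse is the adjugate divided by a nonvanishing determinant. -/
lemma continuousOn_absorptionTime_restrictTo {S : Set (Matrix Z Z ℝ)}
    (h : ∀ T ∈ S, IsUnit (1 - restrictTo C T)) (x : C) :
    ContinuousOn (fun T => (restrictTo C T).absorptionTime x) S := by
  have hc : Continuous fun T : Matrix Z Z ℝ => 1 - restrictTo C T :=
    continuous_const.sub (continuous_id.matrix_submatrix _ _)
  have hinv : ContinuousOn (fun T : Matrix Z Z ℝ => (1 - restrictTo C T)⁻¹) S := by
    have he : (fun T : Matrix Z Z ℝ => (1 - restrictTo C T)⁻¹) = fun T =>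
        (1 - restrictTo C T).det⁻¹ • (1 - restrictTo C T).adjugate := by
      funext T
      rw [Matrix.inv_def, Ring.inverse_eq_inv']
    rw [he]
    refine ContinuousOn.smul (hc.matrix_det.continuousOn.inv₀ fun T hT => ?_)
      hc.matrix_adjugate.continuousOn
    exact ((Matrix.isUnit_iff_isUnit_det _).1 (h T hT)).ne_zero
  have : (fun T : Matrix Z Z ℝ => (restrictTo C T).absorptionTime x) =
      fun T => ∑ y, (1 - restrictTo C T)⁻¹ x y := by
    funext T
    exact Matrix.mulVec_one_apply _ x
  rw [this]
  exact continuousOn_finsetSum _ fun y _ =>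
    ((continuous_apply_apply x y).comp_continuousOn hinv)

/-- If all restrictions to `C` are strictly substochastic after `N` steps, then one matrix
maximizes the expected time spent in `C`, from all states of `C` simultaneously. -/
lemma exists_maximal_absorptionTime (h_nonempty : 𝒯.Nonempty) (h_compact : IsCompact 𝒯)
    (h_ssr : SeparatelySpecifiedRows 𝒯) (h_nonneg : ∀ T ∈ 𝒯, ∀ x y, 0 ≤ T x y) {N : ℕ}
    (hN : ∀ T ∈ 𝒯, ∀ x, (restrictTo C T ^ N *ᵥ 1) x < 1) :
    ∃ S ∈ 𝒯, ∀ T ∈ 𝒯, (restrictTo C T).absorptionTime ≤ (restrictTo C S).absorptionTime := by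
  classical
  have hM : ∀ T ∈ 𝒯, ∀ x y, 0 ≤ restrictTo C T x y := fun T hT =>
    restrictTo_nonneg (h_nonneg T hT)
  have hu : ∀ T ∈ 𝒯, IsUnit (1 - restrictTo C T) := fun T hT =>
    Matrix.isUnit_one_sub_of_pow_lt_one (hM T hT) (hN T hT)
  obtain ⟨S, hS, hmax⟩ := h_compact.exists_isMaxOn h_nonempty
    (continuousOn_finsetSum Finset.univ fun x _ => continuousOn_absorptionTime_restrictTo hu x)
  refine ⟨S, hS, fun T hT => ?_⟩
  set h := (restrictTo C S).absorptionTime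
  have hheq : h = 1 + restrictTo C S *ᵥ h := Matrix.absorptionTime_eq (hu S hS)
  -- Policy improvement: if a row of `T` violated this at `x₀`, putting that row into `S` would
  -- lower no entry of `h` and raise the one at `x₀`, contradicting the maximal sum.
  have hopt : ∀ T ∈ 𝒯, 1 + restrictTo C T *ᵥ h ≤ h := by
    intro T hT x₀
    by_contra! hlt
    obtain ⟨T', hT', hT'0, hT'1⟩ : ∃ T' ∈ 𝒯, T' x₀ = T x₀ ∧ ∀ z : Z, z ≠ x₀ → T' z = S z :=
      ⟨_, h_ssr.mem_of_rows (r := fun z => if z = x₀ then T else S) fun z => by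
        split_ifs <;> assumption, by simp, fun z hz => by simp [hz]⟩
    have hrow0 : (restrictTo C T' *ᵥ h) x₀ = (restrictTo C T *ᵥ h) x₀ := by
      simp [Matrix.mulVec, dotProduct, restrictTo, hT'0]
    have hrow : ∀ x, x ≠ x₀ → (restrictTo C T' *ᵥ h) x = (restrictTo C S *ᵥ h) x := by
      intro x hx
      simp [Matrix.mulVec, dotProduct, restrictTo, hT'1 x fun h => hx (Subtype.ext h)]
    set h' := (restrictTo C T').absorptionTime
    have hheq' : h' = 1 + restrictTo C T' *ᵥ h' := Matrix.absorptionTime_eq (hu T' hT')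
    have himp : h ≤ 1 + restrictTo C T' *ᵥ h := by
      intro x
      by_cases hx : x = x₀
      · subst hx
        rw [Pi.add_apply, hrow0]
        exact hlt.le
      · rw [Pi.add_apply, hrow x hx, ← Pi.add_apply, ← hheq]
    have hw : 0 ≤ h' - h := Matrix.nonneg_of_mulVec_le_self (hM T' hT') (hN T' hT') (by
      rw [Matrix.mulVec_sub]
      intro x
      have h1 := himp x
      have h2 := congrFun hheq' x
      simp only [Pi.add_apply, Pi.sub_apply] at *
      linarith)
    have hstrict : h x₀ < h' x₀ := by
      have h1 := Matrix.mulVec_mono_of_nonneg (hM T' hT') (sub_nonneg.1 hw) x₀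
      have h2 := congrFun hheq' x₀
      simp only [Pi.add_apply] at *
      linarith
    have := hmax hT'
    exact absurd this (not_le.2 (Finset.sum_lt_sum (fun x _ => sub_nonneg.1 hw x)
      ⟨x₀, Finset.mem_univ _, hstrict⟩))
  have hTeq := Matrix.absorptionTime_eq (hu T hT)
  -- By `hopt`, the difference of the two absorption times satisfies the maximum principle for `T`.
  refine sub_nonneg.1 (Matrix.nonneg_of_mulVec_le_self (hM T hT) (hN T hT) ?_)
  rw [Matrix.mulVec_sub]
  intro x
  have h1 := hopt T hT x
  have h2 := congrFun hTeq x
  simp only [Pi.add_apply, Pi.sub_apply] at *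
  linarith

open scoped Classical in
-- Mass leaving `C` enters `A`, where it is killed.
lemma pow_killedMatrix_mulVec_one_eq_restrictTo [Fintype Z] {T : Matrix Z Z ℝ} (hCA : C ⊆ Aᶜ)
    (hclosed : ∀ x ∈ C, ∀ y ∉ A, y ∉ C → T x y = 0) (n : ℕ) (x : C) :
    (killedMatrix A T ^ n *ᵥ 1) x = (restrictTo C T ^ n *ᵥ 1) x := by
  induction n generalizing x with
  | zero => simp
  | succ n ih =>
    rw [pow_succ', ← Matrix.mulVec_mulVec, pow_succ', ← Matrix.mulVec_mulVec, Matrix.mulVec,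
      dotProduct, ← Fintype.sum_coe_eq_sum (C := C)]
    · refine Finset.sum_congr rfl fun y _ => ?_
      rw [ih y, killedMatrix_of_notMem (hCA x.2) (hCA y.2)]
      rfl
    · intro y hy
      by_cases hyA : y ∈ A
      · simp [killedMatrix, hyA]
      · rw [killedMatrix_of_notMem (hCA x.2) hyA, hclosed x x.2 y hyA hy, zero_mul]

/-- Remaining in `C` excludes being in `A`. For the `n`-th lower iterate `g`, induction uses `T *ᵥ
(1 - g) = 1 - T *ᵥ g`, and `T *ᵥ g` dominates the next iterate on `C`. -/
lemma pow_restrictTo_mulVec_one_le [Fintype Z] (h_trans : ∀ T ∈ 𝒯, IsTransitionMatrix T)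
    (hCA : C ⊆ Aᶜ) {T : Matrix Z Z ℝ} (hT : T ∈ 𝒯) (n : ℕ) (x : C) :
    (restrictTo C T ^ n *ᵥ 1) x ≤
      1 - (lowerTransition (stoppedAt A 𝒯))^[n] (A.indicator 1) x := by
  have ht := isTransitionMatrix_of_mem_stoppedAt (A := A) h_trans
  have hind : (0 : Z → ℝ) ≤ A.indicator 1 := Set.indicator_nonneg fun _ _ => zero_le_one
  have hind1 : (A.indicator 1 : Z → ℝ) ≤ 1 :=
    Set.indicator_le_self' fun _ _ => zero_le_one
  induction n generalizing x with
  | zero => simp [show (x : Z) ∉ A from hCA x.2]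
  | succ n ih =>
    rw [pow_succ', ← Matrix.mulVec_mulVec, Function.iterate_succ_apply']
    set g := (lowerTransition (stoppedAt A 𝒯))^[n] (A.indicator 1) with hg
    have hg0 : 0 ≤ g := iterate_lowerTransition_nonneg ht hind n
    have hg1 : g ≤ 1 := iterate_lowerTransition_le_one ht ⟨_, Set.mem_image_of_mem _ hT⟩
      hind hind1 n
    have h1 := lowerTransition_le ht hg0 (Set.mem_image_of_mem (stopMatrix A) hT) x
    rw [stopMatrix_mulVec_of_notMem (hCA x.2)] at h1
    have h2 : (restrictTo C T *ᵥ (restrictTo C T ^ n *ᵥ 1)) x ≤ (T *ᵥ (1 - g)) x := by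
      calc _ ≤ ∑ y : C, T x y * (1 - g y) := Finset.sum_le_sum fun y _ =>
            mul_le_mul_of_nonneg_left (ih y) ((h_trans T hT).1 x y)
        _ = ∑ y, C.indicator (fun y => T x y * (1 - g y)) y := by
            rw [← Fintype.sum_coe_eq_sum (C := C) fun y hy => Set.indicator_of_notMem hy _]
            exact Finset.sum_congr rfl fun y _ => (Set.indicator_of_mem y.2
              fun y => T x y * (1 - g y)).symm
        _ ≤ _ := Finset.sum_le_sum fun y _ => Set.indicator_le_self' (fun z _ =>
            mul_nonneg ((h_trans T hT).1 x z) (sub_nonneg.2 (hg1 z))) y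
    rw [Matrix.mulVec_sub, (h_trans T hT).mulVec_one, Pi.sub_apply, Pi.one_apply] at h2
    linarith

end Restrict

end Maximization

/-! ### The theorem -/

open scoped Classical in
theorem theorem3 {Z : Type*} [Fintype Z] [MeasurableSpace Z] [DiscreteMeasurableSpace Z]
    (𝒯 : Set (Matrix Z Z ℝ)) (A : Set Z)
    (h_trans : ∀ T ∈ 𝒯, IsTransitionMatrix T)
    (h_nonempty : 𝒯.Nonempty) (h_compact : IsCompact 𝒯) (h_convex : Convex ℝ 𝒯)
    (h_ssr : SeparatelySpecifiedRows 𝒯) :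
    (∀ x ∈ infiniteStates 𝒯 A, upperExpectedHittingTime 𝒯 A x = ⊤) ∧
    ∃ T ∈ 𝒯,
      IsUnit (1 - restrictTo (Aᶜ \ infiniteStates 𝒯 A) T) ∧
      ∀ x : ↥(Aᶜ \ infiniteStates 𝒯 A),
        ((upperExpectedHittingTime 𝒯 A (x : Z) : ℝ≥0∞) : EReal) =
          ((((1 - restrictTo (Aᶜ \ infiniteStates 𝒯 A) T)⁻¹ *ᵥ 1) x : ℝ) : EReal) := by
  refine ⟨fun x hx => ?_, ?_⟩
  · rw [upperExpectedHittingTime_eq_iSup h_trans (notMem_of_mem_infiniteStates hx)]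
    obtain ⟨T, hT, h⟩ := exists_pow_killedMatrix_bounded_below (A := A) h_trans h_nonempty
      h_compact h_ssr
    obtain ⟨ε, hε, hb⟩ := h x hx
    refine top_le_iff.1 (le_iSup₂_of_le T hT ?_)
    rw [← ENNReal.tsum_const_eq_top_of_ne_zero (α := ℕ) (ENNReal.ofReal_pos.2 hε).ne']
    exact ENNReal.tsum_le_tsum fun n => ENNReal.ofReal_le_ofReal (hb n)
  · set C := Aᶜ \ infiniteStates 𝒯 A
    have hCA : C ⊆ Aᶜ := Set.sdiff_subset
    obtain ⟨N, hN⟩ := exists_iterate_lowerTransition_pos (A := A) h_trans h_nonempty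
    -- The same `N` works for all of `𝒯`, as the lower iterate bounds every member.
    have hlt : ∀ T ∈ 𝒯, ∀ x : C, (restrictTo C T ^ N *ᵥ 1) x < 1 := fun T hT x =>
      (pow_restrictTo_mulVec_one_le h_trans hCA hT N x).trans_lt
        (sub_lt_self _ (hN x fun h => x.2.2 (Or.inl h)))
    have hclosed : ∀ T ∈ 𝒯, ∀ x ∈ C, ∀ y ∉ A, y ∉ C → T x y = 0 := by
      intro T hT x hx y hyA hyC
      by_contra hne
      have hy : y ∈ infiniteStates 𝒯 A := by
        by_contra h
        exact hyC ⟨hyA, h⟩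
      exact hx.2 (mem_infiniteStates_of_step h_trans hx.1 hT
        (lt_of_le_of_ne ((h_trans T hT).1 x y) (Ne.symm hne)) hy)
    have hM : ∀ T ∈ 𝒯, ∀ x y, 0 ≤ restrictTo C T x y := fun T hT =>
      restrictTo_nonneg (h_trans T hT).1
    obtain ⟨S, hS, hmax⟩ := exists_maximal_absorptionTime (C := C) h_nonempty h_compact h_ssr
      (fun T hT => (h_trans T hT).1) hlt
    refine ⟨S, hS, Matrix.isUnit_one_sub_of_pow_lt_one (hM S hS) (hlt S hS), fun x => ?_⟩
    have hpow0 : ∀ T ∈ 𝒯, ∀ n, 0 ≤ (restrictTo C T ^ n *ᵥ 1) x := fun T hT n =>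
      Matrix.mulVec_nonneg_of_nonneg (Matrix.pow_apply_nonneg (hM T hT) n) zero_le_one x
    have hsum : ∀ T ∈ 𝒯, ∑' n : ℕ, ENNReal.ofReal ((killedMatrix A T ^ n *ᵥ 1) x) =
        ENNReal.ofReal ((restrictTo C T).absorptionTime x) := by
      intro T hT
      have hs := Matrix.hasSum_pow_mulVec_one (hM T hT) (hlt T hT) x
      simp_rw [pow_killedMatrix_mulVec_one_eq_restrictTo hCA (hclosed T hT)]
      rw [← ENNReal.ofReal_tsum_of_nonneg (hpow0 T hT) hs.summable, hs.tsum_eq]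
    have heq : upperExpectedHittingTime 𝒯 A x =
        ENNReal.ofReal ((restrictTo C S).absorptionTime x) := by
      rw [upperExpectedHittingTime_eq_iSup h_trans (hCA x.2)]
      refine le_antisymm (iSup₂_le fun T hT => ?_) (le_iSup₂_of_le S hS (hsum S hS).ge)
      rw [hsum T hT]
      exact ENNReal.ofReal_le_ofReal (hmax T hT x)
    rw [heq, EReal.coe_ennreal_ofReal, max_eq_left]
    · rfl
    · exact (Matrix.hasSum_pow_mulVec_one (hM S hS) (hlt S hS) x).nonneg (hpow0 S hS)
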